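/- A plot of a diffeological space $X$ is a map $U \to X$, with $U$ open in some $\mathbb{R}^m$, that belongs to the diffeology. The $D$-dimension of $X$ is the infimum, over all sets of plots generating the diffeology of $X$, of the supremum of the dimensions of the domains of these plots. For $k \ge 0$, let $\Omega^k(X)$ be the limit of the vector spaces $\Omega^k(U)$ of smooth $k$-forms over all plots $U \to X$. Let $T^kX \to X$ be the colimit, in the category of diffeological vector pseudo-bundles, of the bundles $\Lambda^k TU \to U$ over all plots $U \to X$. Its fibre $T^k_x(X)$ over $x$ is the colimit of the vector spaces $\Lambda^k T_aU$ over all plots $p : U \to X$ and points $a \in U$ with $p(a) = x$, and its total space carries the smallest diffeology that makes it a diffeological vector pseudo-bundle over $X$ and all canonical maps $\Lambda^k TU \to T^kX$ smooth. Let $T_x(X)$ be the colimit of the tangent spaces $T_aU$ over the same plots and points; these are the fibres of the internal tangent bundle $T^{\mathrm{dvs}}X \to X$. Let $\Lambda^k T^{\mathrm{dvs}}X$ be its fibrewise exterior power, and let $\rho : T^kX \to \Lambda^k T^{\mathrm{dvs}}X$ be the map over $X$ induced by the maps $\Lambda^k T_aU \to \Lambda^k T_x(X)$. (1) Let $X$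 be a diffeological space of $D$-dimension $n \in \mathbb{N}$, and let $k > n$. Then the projection $T^kX \to X$ is a diffeomorphism, all its fibres $T^k_x(X)$ are zero, and $\Omega^k(X) = 0$. (2) Let $X_g$ be the union of the two coordinate axes in $\mathbb{R}^2$ with the gluing diffeology, that is, the quotient diffeology from the disjoint union of the two lines with their origins identified. Then the fibre $\Lambda^2 T_0(X_g)$ of $\Lambda^2 T^{\mathrm{dvs}}X_g$ at the origin is $1$-dimensional, and $\rho : T^2X_g \to \Lambda^2 T^{\mathrm{dvs}}X_g$ is not surjective. -/

import Mathlib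

universe u

open Diffeology
open scoped ContDiff

noncomputable section

namespace DiffBundle

/-- Euclidean `n`-space. -/
abbrev Euc (n : ℕ) : Type := EuclideanSpace ℝ (Fin n)

/-! ### Plots on open subsets and the plot category

Mathlib records a diffeology by its plots with domain a whole Euclidean space.  A map on an open
subset `U` of `ℝⁿ` is a plot iff all its composites with smooth maps `ℝᵐ → U` are plots; this is
the unique extension that is compatible with restriction and locality. -/

/-- `p : U → X` is a plot of the diffeology `d` (here `U` is meant to be open in `ℝⁿ`). -/
def IsPlotOn {X : Type u} (d : DiffeologicalSpace X) {n : ℕ} (U : Set (Euc n)) (p : U → X) : Prop :=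
  ∀ (m : ℕ) (g : Euc m → Euc n) (hg : ∀ y, g y ∈ U), ContDiff ℝ ∞ g →
    (fun y => p ⟨g y, hg y⟩) ∈ d.plots m

/-- Objects of the plot category of `X`: plots `U → X` with `U` open in some `ℝⁿ`. -/
structure Plot (X : Type u) [d : DiffeologicalSpace X] where
  dim : ℕ
  dom : Set (Euc dim)
  isOpen_dom : IsOpen dom
  toFun : dom → X
  isPlotOn : IsPlotOn d dom toFun

/-- The map `f` represents a morphism `p → q` in the plot category: on the domain of `p` it is
smooth, takes values in the domain of `q`, and satisfies `q ∘ f = p`.  The values of `f` off the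
domain of `p` play no role. -/
structure Plot.IsHom {X : Type u} [DiffeologicalSpace X] (p q : Plot X)
    (f : Euc p.dim → Euc q.dim) : Prop where
  contDiffOn : ContDiffOn ℝ ∞ f p.dom
  mapsTo : ∀ a : p.dom, f a ∈ q.dom
  comm : ∀ a : p.dom, q.toFun ⟨f a, mapsTo a⟩ = p.toFun a

/-! ### The D-dimension -/

/-- A set of plots generates the diffeology of `X` if the latter is the smallest diffeology that
contains these plots. -/
def Generates {X : Type u} [d : DiffeologicalSpace X] (G : Set (Plot X)) : Prop :=
  ∀ d' : DiffeologicalSpace X, (∀ p ∈ G, IsPlotOn d' (@Plot.dom X d p) (@Plot.toFun X d p)) → d ≤ d'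

/-- The D-dimension: the infimum, over all generating sets of plots, of the supremum of the
dimensions of the domains of the plots in the set. -/
def dDim (X : Type u) [DiffeologicalSpace X] : ℕ∞ :=
  ⨅ (G : Set (Plot X)) (_ : Generates G), ⨆ p ∈ G, (p.dim : ℕ∞)

/-- A diffeomorphism: a smooth map with a smooth two-sided inverse. -/
def IsDiffeomorphism {X Y : Type*} [DiffeologicalSpace X] [DiffeologicalSpace Y] (f : X → Y) :
    Prop :=
  DSmooth f ∧ ∃ g : Y → X, DSmooth g ∧ Function.LeftInverse g f ∧ Function.RightInverse g f

/-! ### Differential forms -/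

/-- The differential `k`-forms on `X`, that is, the limit of the spaces of smooth `k`-forms on `U`
over all plots `U → X`: families of smooth forms that are compatible with pullback. -/
def Form (k : ℕ) (X : Type u) [DiffeologicalSpace X] :
    Submodule ℝ (∀ p : Plot X, p.dom → (Euc p.dim [⋀^Fin k]→L[ℝ] ℝ)) where
  carrier := {θ |
    (∀ p : Plot X, ContDiffOn ℝ ∞ (Function.extend Subtype.val (θ p) 0) p.dom) ∧
    ∀ (p q : Plot X) (f : Euc p.dim → Euc q.dim) (hf : p.IsHom q f) (a : p.dom),
      θ p a = (θ q ⟨f a, hf.mapsTo a⟩).compContinuousLinearMap (fderiv ℝ f a)}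
  add_mem' := by
    rintro θ η ⟨h1, h2⟩ ⟨h3, h4⟩
    refine ⟨fun p => ((h1 p).add (h3 p)).congr fun x hx => ?_, fun p q f hf a => ?_⟩
    · have e := fun ζ : p.dom → (Euc p.dim [⋀^Fin k]→L[ℝ] ℝ) =>
        Subtype.val_injective.extend_apply ζ 0 ⟨x, hx⟩
      simp only at e
      simp [e]
    · simp only [Pi.add_apply]
      rw [h2 p q f hf a, h4 p q f hf a]
      rfl
  zero_mem' := by
    refine ⟨fun p => (contDiffOn_const (c := 0)).congr fun x hx => ?_, fun p q f hf a => ?_⟩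
    · exact Subtype.val_injective.extend_apply
        (0 : p.dom → (Euc p.dim [⋀^Fin k]→L[ℝ] ℝ)) 0 ⟨x, hx⟩
    · rfl
  smul_mem' := by
    rintro c θ ⟨h1, h2⟩
    refine ⟨fun p => ((h1 p).const_smul c).congr fun x hx => ?_, fun p q f hf a => ?_⟩
    · have e := fun ζ : p.dom → (Euc p.dim [⋀^Fin k]→L[ℝ] ℝ) =>
        Subtype.val_injective.extend_apply ζ 0 ⟨x, hx⟩
      simp only at e
      simp [e]
    · simp only [Pi.smul_apply]
      rw [h2 p q f hf a]
      rfl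

/-! ### Diffeological vector pseudo-bundles -/

/-- The diffeology `d` on the total space makes `Σ b, E b → B` into a diffeological vector
pseudo-bundle: the projection, the fibrewise addition on `E ×_B E`, the scalar multiplication
on `ℝ × E` and the zero section are smooth (the middle two are spelled out on plots). -/
structure IsPseudoBundle {B : Type*} [DiffeologicalSpace B] {E : B → Type*}
    [∀ b, AddCommGroup (E b)] [∀ b, Module ℝ (E b)] (d : DiffeologicalSpace (Σ b, E b)) :
    Prop where
  smooth_proj : DSmooth (Sigma.fst : (Σ b, E b) → B)
  smooth_add : ∀ (n : ℕ) (q : Euc n → B) (s t : ∀ x, E (q x)),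
    (fun x => (⟨q x, s x⟩ : Σ b, E b)) ∈ d.plots n →
    (fun x => (⟨q x, t x⟩ : Σ b, E b)) ∈ d.plots n →
    (fun x => (⟨q x, s x + t x⟩ : Σ b, E b)) ∈ d.plots n
  smooth_smul : ∀ (n : ℕ) (r : Euc n → ℝ) (q : Euc n → B) (s : ∀ x, E (q x)),
    IsPlot r → (fun x => (⟨q x, s x⟩ : Σ b, E b)) ∈ d.plots n →
    (fun x => (⟨q x, r x • s x⟩ : Σ b, E b)) ∈ d.plots n
  smooth_zero : DSmooth (fun b => (⟨b, 0⟩ : Σ b, E b))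

/-- Dvsification: the smallest diffeology that contains `d` and makes `Σ b, E b → B` into a
diffeological vector pseudo-bundle. -/
@[reducible]
def dvsification {B : Type*} [DiffeologicalSpace B] {E : B → Type*}
    [∀ b, AddCommGroup (E b)] [∀ b, Module ℝ (E b)] (d : DiffeologicalSpace (Σ b, E b)) :
    DiffeologicalSpace (Σ b, E b) :=
  sInf {d' | d ≤ d' ∧ IsPseudoBundle d'}

/-! ### Colimits of trivial bundles over the plot category

Let `F` be a functor from Euclidean spaces and linear maps to finite-dimensional vector spaces.
Applied fibrewise to tangent bundles it gives a bundle `U × F(ℝⁿ) → U` for every plot `U → X`.  We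
form the colimit of these bundles over the plot category of `X`: the fibre over `x` is the colimit
of the `F(T_a U)` over all plots `p : U → X` and `a ∈ U` with `p a = x`, and the total space has
the dvsification of the diffeology generated by the canonical maps `U × F(ℝⁿ) → Σ x, colim`. -/

/-- A plot with a point of its domain that it sends to `x`. -/
structure PlotAt {X : Type u} [DiffeologicalSpace X] (x : X) where
  plot : Plot X
  pt : plot.dom
  map_pt : plot.toFun pt = x

section Colimit

variable (F : ℕ → Type) [∀ n, AddCommGroup (F n)] [∀ n, Module ℝ (F n)]
  (map : ∀ {m n : ℕ}, (Euc m →ₗ[ℝ] Euc n) → F m →ₗ[ℝ] F n)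

open Classical in
/-- The relations of the colimit: `v` at `α` is identified with the image of `v` under the
derivative at the base point of `α` of any morphism of pointed plots `α → β`. -/
def colimRel {X : Type u} [DiffeologicalSpace X] (x : X) :
    Submodule ℝ (DirectSum (PlotAt x) fun α => F α.plot.dim) :=
  Submodule.span ℝ {z | ∃ (α β : PlotAt x) (f : Euc α.plot.dim → Euc β.plot.dim)
    (v : F α.plot.dim), α.plot.IsHom β.plot f ∧ f α.pt = β.pt ∧
    z = DirectSum.lof ℝ (PlotAt x) (fun α => F α.plot.dim) β
          (map (fderiv ℝ f α.pt).toLinearMap v) -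
        DirectSum.lof ℝ (PlotAt x) (fun α => F α.plot.dim) α v}

/-- The colimit of `F(T_a U)` over the pointed plots `(U, a) → (X, x)`. -/
abbrev ColimFibre {X : Type u} [DiffeologicalSpace X] (x : X) : Type u :=
  (DirectSum (PlotAt x) fun α => F α.plot.dim) ⧸ colimRel F map x

open Classical in
/-- The canonical map from `F(T_a U)` to the colimit. -/
def ColimFibre.ι {X : Type u} [DiffeologicalSpace X] {x : X} (α : PlotAt x) :
    F α.plot.dim →ₗ[ℝ] ColimFibre F map x :=
  (colimRel F map x).mkQ ∘ₗ DirectSum.lof ℝ (PlotAt x) (fun α => F α.plot.dim) α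

/-- The diffeology on the total space.  A plot of `U × F(ℝⁿ)` is a pair of smooth maps `g` to `U`
and `w` to `F(ℝⁿ)`; smoothness of a map to the finite-dimensional space `F(ℝⁿ)` is tested on
linear functionals. -/
@[reducible]
def colimDiffeology (X : Type u) [DiffeologicalSpace X] :
    DiffeologicalSpace (Σ x : X, ColimFibre F map x) :=
  dvsification (DiffeologicalSpace.generateFrom
    {P | ∃ (p : Plot X) (m : ℕ) (g : Euc m → Euc p.dim) (hg : ∀ y, g y ∈ p.dom)
      (w : Euc m → F p.dim), ContDiff ℝ ∞ g ∧
      (∀ l : F p.dim →ₗ[ℝ] ℝ, ContDiff ℝ ∞ fun y => l (w y)) ∧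
      P = ⟨m, fun y => ⟨p.toFun ⟨g y, hg y⟩,
        ColimFibre.ι F map (x := p.toFun ⟨g y, hg y⟩) ⟨p, ⟨g y, hg y⟩, rfl⟩ (w y)⟩⟩})

end Colimit

/-! ### The bundles `T^dvs X`, `⋀ᵏ T^dvs X` and `Tᵏ X` -/

/-- The internal tangent space `T_x X`, the colimit of the tangent spaces `T_a U`. -/
abbrev TanSpace {X : Type u} [DiffeologicalSpace X] (x : X) : Type u :=
  ColimFibre (fun n => Euc n) (fun L => L) x

/-- The internal tangent bundle `T^dvs X`. -/
abbrev TanBundle (X : Type u) [DiffeologicalSpace X] : Type u := Σ x : X, TanSpace x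

/-- The dvsification of Hector's diffeology. -/
instance (X : Type u) [DiffeologicalSpace X] : DiffeologicalSpace (TanBundle X) :=
  colimDiffeology (fun n => Euc n) (fun L => L) X

/-- The bundle `⋀ᵏ T^dvs X`, whose fibre over `x` is `⋀ᵏ (T_x X)`. -/
abbrev ExtTanBundle (k : ℕ) (X : Type u) [DiffeologicalSpace X] : Type u :=
  Σ x : X, ⋀[ℝ]^k (TanSpace x)

/-- The plots of `⋀ᵏ T^dvs X` are locally the finite linear combinations, with smooth
coefficients, of wedge products of plots of `T^dvs X` over a common plot of `X`. -/
instance (k : ℕ) (X : Type u) [DiffeologicalSpace X] : DiffeologicalSpace (ExtTanBundle k X) :=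
  dvsification (DiffeologicalSpace.generateFrom
    {P | ∃ (m : ℕ) (q : Euc m → X) (s : Fin k → ∀ y, TanSpace (q y)),
      IsPlot q ∧ (∀ i, IsPlot fun y => (⟨q y, s i y⟩ : TanBundle X)) ∧
      P = ⟨m, fun y => ⟨q y, exteriorPower.ιMulti ℝ k fun i => s i y⟩⟩})

/-- The fibre of `Tᵏ X` over `x`, the colimit of the exterior powers `⋀ᵏ T_a U`. -/
abbrev TkSpace (k : ℕ) {X : Type u} [DiffeologicalSpace X] (x : X) : Type u :=
  ColimFibre (fun n => ⋀[ℝ]^k (Euc n)) (fun L => exteriorPower.map k L) x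

/-- The bundle `Tᵏ X`, the colimit of the bundles `⋀ᵏ TU → U` over the plots `U → X`. -/
abbrev TkBundle (k : ℕ) (X : Type u) [DiffeologicalSpace X] : Type u := Σ x : X, TkSpace k x

instance (k : ℕ) (X : Type u) [DiffeologicalSpace X] : DiffeologicalSpace (TkBundle k X) :=
  colimDiffeology (fun n => ⋀[ℝ]^k (Euc n)) (fun L => exteriorPower.map k L) X

/-- The projection `Tᵏ X → X`. -/
def TkBundle.proj (k : ℕ) (X : Type u) [DiffeologicalSpace X] : TkBundle k X → X := Sigma.fst

/-- The map `T_a U → T_x X` induced by a pointed plot `(U, a) → (X, x)`. -/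
def tanMap {X : Type u} [DiffeologicalSpace X] {x : X} (α : PlotAt x) :
    Euc α.plot.dim →ₗ[ℝ] TanSpace x :=
  ColimFibre.ι (fun n => Euc n) (fun L => L) α

theorem tanMap_comp {X : Type u} [DiffeologicalSpace X] {x : X} (α β : PlotAt x)
    (f : Euc α.plot.dim → Euc β.plot.dim) (hf : α.plot.IsHom β.plot f) (hpt : f α.pt = β.pt) :
    tanMap β ∘ₗ (fderiv ℝ f α.pt).toLinearMap = tanMap α := by
  ext1 v
  refine (Submodule.Quotient.eq _).2 (Submodule.subset_span ⟨α, β, f, v, hf, hpt, ?_⟩)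
  rfl

open Classical in
/-- The comparison map on fibres `Tᵏ_x X → ⋀ᵏ (T_x X)`, induced by the maps
`⋀ᵏ T_a U → ⋀ᵏ (T_x X)`. -/
def rhoFibre (k : ℕ) {X : Type u} [DiffeologicalSpace X] (x : X) :
    TkSpace k x →ₗ[ℝ] ⋀[ℝ]^k (TanSpace x) :=
  (colimRel (fun n => ⋀[ℝ]^k (Euc n)) (fun L => exteriorPower.map k L) x).liftQ
    (DirectSum.toModule ℝ (PlotAt x) _ fun α => exteriorPower.map k (tanMap α)) (by
      refine Submodule.span_le.2 ?_
      rintro _ ⟨α, β, f, v, hf, hpt, rfl⟩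
      have h := tanMap_comp α β f hf hpt
      simp only [SetLike.mem_coe, LinearMap.mem_ker, map_sub, DirectSum.toModule_lof]
      rw [← LinearMap.comp_apply, ← exteriorPower.map_comp, h, sub_self])

/-- The comparison map `ρ : Tᵏ X → ⋀ᵏ T^dvs X` over `X`. -/
def rho (k : ℕ) (X : Type u) [DiffeologicalSpace X] : TkBundle k X → ExtTanBundle k X :=
  fun e => ⟨e.1, rhoFibre k e.1 e.2⟩

/-! ### The axes with the gluing diffeology -/

/-- The union of the two coordinate axes in `ℝ²`. -/
def Axes : Type := {v : ℝ × ℝ // v.2 = 0 ∨ v.1 = 0}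

/-- The inclusion of the first axis. -/
def Axes.inX (t : ℝ) : Axes := ⟨(t, 0), Or.inl rfl⟩

/-- The inclusion of the second axis. -/
def Axes.inY (t : ℝ) : Axes := ⟨(0, t), Or.inr rfl⟩

/-- The origin. -/
def Axes.origin : Axes := Axes.inX 0

/-- The gluing diffeology, that is, the quotient diffeology from the disjoint union of the two
lines: the smallest diffeology for which both axis inclusions are smooth. -/
instance : DiffeologicalSpace Axes :=
  DiffeologicalSpace.generateFrom
    {P | ∃ (m : ℕ) (g : Euc m → ℝ), IsPlot g ∧ (P = ⟨m, Axes.inX ∘ g⟩ ∨ P = ⟨m, Axes.inY ∘ g⟩)}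

end DiffBundle

end

noncomputable section

namespace DiffBundle

/-! ### Plots on open sets -/

/-! The maps that locally factor smoothly through members of a covering set `G` of plots form a
diffeology containing `G`. If `G` generates, every plot of `X` therefore factors this way near each
point. Consequently every canonical map from `F(T_a U)` to the colimit passes through `F(T_b V)` for
some plot `V → X` in `G` (`Generates.exists_ι_comp`). D-dimension `n` supplies such a `G` with all
dimensions at most `n`. For `k > n` the spaces `⋀ᵏ T_b V` vanish, so the fibres of `Tᵏ X` are zero,
and every `k`-form is locally a pullback of zero. The projection then has the smooth zero section as
its inverse. For the axes, `G` consists of the two lines, so `T²` vanishes at the origin. But the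
tangent space there has the two axis vectors as a basis: they span by the same factorisation, and
the differentials of the two coordinates separate them. Its exterior square is a line, which a zero
space cannot cover. -/

/-- The diffeology of all maps whose composite with `f` is a plot. -/
@[reducible]
def comapDiffeology {X Y : Type*} [DiffeologicalSpace Y] (f : X → Y) : DiffeologicalSpace X where
  plots n := {p | IsPlot (f ∘ p)}
  constant_plots x := isPlot_const (x := f x)
  plot_reparam hp hf := isPlot_reparam hp hf
  locality hp := DiffeologicalSpace.locality fun x => by
    obtain ⟨u, hu, hxu, h⟩ := hp x
    exact ⟨u, hu, hxu, fun hfu hf => h hfu hf⟩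

/-- Around every point of an open set `U`, a plot on `U` is, up to a smooth change of
coordinates, a plot on all of Euclidean space. -/
theorem IsPlotOn.exists_chart {X : Type*} {d : DiffeologicalSpace X} {n : ℕ} {U : Set (Euc n)}
    {p : U → X} (hU : IsOpen U) (hp : IsPlotOn d U p) (a : U) :
    ∃ (V : Set (Euc n)) (hVU : V ⊆ U) (P : Euc n → X) (s : Euc n → Euc n), IsOpen V ∧ ↑a ∈ V ∧
      P ∈ d.plots n ∧ ContDiffOn ℝ ∞ s V ∧ ∀ y (hy : y ∈ V), P (s y) = p ⟨y, hVU hy⟩ := by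
  obtain ⟨ε, hε, hball⟩ := Metric.isOpen_iff.mp hU a a.2
  -- A diffeomorphism of `ℝⁿ` onto a ball inside `U` turns the plot into a global one; its inverse
  -- is the chart `s`.
  set e := OpenPartialHomeomorph.univBall (a : Euc n) ε with he
  have htgt : e.target = Metric.ball (a : Euc n) ε := OpenPartialHomeomorph.univBall_target _ hε
  have hmem : ∀ y, e y ∈ U := fun y => hball <| by
    rw [← htgt]
    exact e.map_source (by simp [he])
  refine ⟨Metric.ball a ε, hball, fun y => p ⟨e y, hmem y⟩, e.symm, Metric.isOpen_ball,
    Metric.mem_ball_self hε, hp n e hmem OpenPartialHomeomorph.contDiff_univBall,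
    OpenPartialHomeomorph.contDiffOn_univBall_symm, fun y hy => ?_⟩
  have : e (e.symm y) = y := e.right_inv (htgt ▸ hy)
  simp only [this]

theorem IsPlotOn.contDiffOn_extend {n : ℕ} {U : Set (Euc n)} {p : U → ℝ} (hU : IsOpen U)
    (hp : IsPlotOn inferInstance U p) :
    ContDiffOn ℝ ∞ (Function.extend Subtype.val p 0) U := by
  intro a ha
  obtain ⟨V, hVU, P, s, hV, haV, hP, hs, h⟩ := hp.exists_chart hU ⟨a, ha⟩
  have hP' : ContDiff ℝ ∞ P := IsPlot.contDiff hP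
  have : ContDiffOn ℝ ∞ (Function.extend Subtype.val p 0) V :=
    (hP'.comp_contDiffOn hs).congr fun y hy => by
      rw [Function.comp_apply, h y hy]
      exact Subtype.val_injective.extend_apply p 0 ⟨y, hVU hy⟩
  exact ((this a haV).contDiffAt (hV.mem_nhds haV)).contDiffWithinAt

/-! ### Local factorisation through a generating set -/

section Factor

variable {X : Type u} [d : DiffeologicalSpace X]

/-- The restriction of a plot to an open subset of its domain. -/
abbrev Plot.restrict (p : Plot X) (V : Set (Euc p.dim)) (hV : IsOpen V) (hVp : V ⊆ p.dom) :
    Plot X where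
  dim := p.dim
  dom := V
  isOpen_dom := hV
  toFun y := p.toFun ⟨y, hVp y.2⟩
  isPlotOn m g hg hc := p.isPlotOn m g (fun y => hVp (hg y)) hc

theorem Plot.restrict_isHom (p : Plot X) (V : Set (Euc p.dim)) (hV : IsOpen V)
    (hVp : V ⊆ p.dom) : (p.restrict V hV hVp).IsHom p (fun y => y) where
  contDiffOn := contDiffOn_id
  mapsTo a := hVp a.2
  comm _ := rfl

/-- The plot `ℝ⁰ → X` with value `x`. -/
abbrev Plot.point (x : X) : Plot X where
  dim := 0
  dom := Set.univ
  isOpen_dom := isOpen_univ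
  toFun _ := x
  isPlotOn _ _ _ _ := d.constant_plots x

/-- Near `x`, the map `p` factors smoothly through a plot in `G`. -/
def FactorsNear (G : Set (Plot X)) {m : ℕ} (p : Euc m → X) (x : Euc m) : Prop :=
  ∃ V : Set (Euc m), IsOpen V ∧ x ∈ V ∧ ∃ q ∈ G, ∃ f : Euc m → Euc q.dim,
    ContDiffOn ℝ ∞ f V ∧ ∀ y ∈ V, ∃ h : f y ∈ q.dom, q.toFun ⟨f y, h⟩ = p y

theorem FactorsNear.comp {G : Set (Plot X)} {m n : ℕ} {p : Euc m → X} {f : Euc n → Euc m}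
    {v : Set (Euc n)} (hv : IsOpen v) (hf : ContDiffOn ℝ ∞ f v) {x : Euc n} (hx : x ∈ v)
    (hp : FactorsNear G p (f x)) : FactorsNear G (p ∘ f) x := by
  obtain ⟨V, hV, hxV, q, hq, g, hg, h⟩ := hp
  exact ⟨v ∩ f ⁻¹' V, hf.continuousOn.isOpen_inter_preimage hv hV, ⟨hx, hxV⟩, q, hq, g ∘ f,
    hg.comp (hf.mono Set.inter_subset_left) fun y hy => hy.2, fun y hy => h _ hy.2⟩

theorem FactorsNear.congr {G : Set (Plot X)} {m : ℕ} {p p' : Euc m → X} {u : Set (Euc m)}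
    (hu : IsOpen u) (h : Set.EqOn p p' u) {x : Euc m} (hx : x ∈ u) (hp : FactorsNear G p x) :
    FactorsNear G p' x := by
  obtain ⟨V, hV, hxV, q, hq, g, hg, hc⟩ := hp
  exact ⟨V ∩ u, hV.inter hu, ⟨hxV, hx⟩, q, hq, g, hg.mono Set.inter_subset_left,
    fun y hy => h hy.2 ▸ hc y hy.1⟩

/-- The diffeology of the maps that locally factor through plots in `G`. -/
@[reducible]
def factorDiffeology (G : Set (Plot X)) (hcov : ∀ x, ∃ q ∈ G, ∃ a, q.toFun a = x) :
    DiffeologicalSpace X :=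
  .ofCorePlotsOn
    { isPlotOn := fun {_ u} _ p => ∀ x ∈ u, FactorsNear G p x
      isPlotOn_congr := fun hu _ _ h => forall₂_congr fun _ hx =>
        ⟨.congr hu h hx, .congr hu h.symm hx⟩
      -- Covering is needed exactly here: a generating set may omit points that only constant plots
      -- reach.
      isPlot_const := fun x y _ => by
        obtain ⟨q, hq, a, ha⟩ := hcov x
        exact ⟨Set.univ, isOpen_univ, trivial, q, hq, fun _ => a, contDiffOn_const,
          fun _ _ => ⟨a.2, ha⟩⟩
      isPlotOn_reparam := fun hv _ _ h hp hf x hx => (hp _ (h hx)).comp hv hf hx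
      locality := fun _ _ h x hx => by
        obtain ⟨v, _, hxv, h'⟩ := h x hx
        exact h' x hxv }

/-- Every plot factors locally through the plots in a generating set that covers `X`. -/
theorem Generates.exists_isHom {G : Set (Plot X)} (hG : Generates G)
    (hcov : ∀ x, ∃ q ∈ G, ∃ a, q.toFun a = x) (p : Plot X) (a : p.dom) :
    ∃ (V : Set (Euc p.dim)) (hV : IsOpen V) (hVp : V ⊆ p.dom), ↑a ∈ V ∧ ∃ q ∈ G,
      ∃ f : Euc p.dim → Euc q.dim, (p.restrict V hV hVp).IsHom q f := by
  -- Members of `G` factor through themselves, so minimality of `d` applies.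
  have hle : d ≤ factorDiffeology G hcov := hG _ fun q hq m g hg hgc x _ =>
    ⟨Set.univ, isOpen_univ, trivial, q, hq, g, hgc.contDiffOn, fun y _ => ⟨hg y, rfl⟩⟩
  obtain ⟨V, hVp, P, s, hV, haV, hP, hs, hPs⟩ := p.isPlotOn.exists_chart p.isOpen_dom a
  have hfac : FactorsNear G P (s a) := DiffeologicalSpace.le_iff.1 hle _ hP _ trivial
  obtain ⟨W, hW, haW, q, hq, f, hf, h⟩ := hfac.comp hV hs haV
  refine ⟨V ∩ W, hV.inter hW, fun y hy => hVp hy.1, ⟨haV, haW⟩, q, hq, f,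
    hf.mono Set.inter_subset_right, fun y => (h y y.2.2).1, fun y => ?_⟩
  exact (h y y.2.2).2.trans (hPs y y.2.1)

/-! ### Vanishing above the dimension -/

theorem ColimFibre.ι_isHom (F : ℕ → Type) [∀ n, AddCommGroup (F n)] [∀ n, Module ℝ (F n)]
    (map : ∀ {m n : ℕ}, (Euc m →ₗ[ℝ] Euc n) → F m →ₗ[ℝ] F n) {x : X} (α β : PlotAt x)
    (f : Euc α.plot.dim → Euc β.plot.dim) (hf : α.plot.IsHom β.plot f) (hpt : f α.pt = β.pt)
    (v : F α.plot.dim) :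
    ColimFibre.ι F map β (map (fderiv ℝ f α.pt).toLinearMap v) = ColimFibre.ι F map α v :=
  (Submodule.Quotient.eq _).2 (Submodule.subset_span ⟨α, β, f, v, hf, hpt, rfl⟩)

open Classical in
theorem ColimFibre.hom_ext (F : ℕ → Type) [∀ n, AddCommGroup (F n)] [∀ n, Module ℝ (F n)]
    (map : ∀ {m n : ℕ}, (Euc m →ₗ[ℝ] Euc n) → F m →ₗ[ℝ] F n) {x : X} {M : Type*}
    [AddCommGroup M] [Module ℝ M] {f g : ColimFibre F map x →ₗ[ℝ] M}
    (h : ∀ α, f ∘ₗ ColimFibre.ι F map α = g ∘ₗ ColimFibre.ι F map α) : f = g := by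
  exact Submodule.linearMap_qext _ (DirectSum.linearMap_ext ℝ h)

/-- The pointed plot given by restriction to an open neighbourhood of the base point. -/
abbrev PlotAt.restrict {x : X} (α : PlotAt x) (V : Set (Euc α.plot.dim)) (hV : IsOpen V)
    (hVp : V ⊆ α.plot.dom) (ha : ↑α.pt ∈ V) : PlotAt x where
  plot := α.plot.restrict V hV hVp
  pt := ⟨α.pt, ha⟩
  map_pt := α.map_pt

/-- In the colimit, every `F(T_a U)` maps through `F(T_b V)` for some plot `V → X` in a
generating set. -/
theorem Generates.exists_ι_comp {G : Set (Plot X)} (hG : Generates G)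
    (hcov : ∀ x, ∃ q ∈ G, ∃ a, q.toFun a = x)
    (F : ℕ → Type) [∀ n, AddCommGroup (F n)] [∀ n, Module ℝ (F n)]
    (map : ∀ {m n : ℕ}, (Euc m →ₗ[ℝ] Euc n) → F m →ₗ[ℝ] F n)
    (map_id : ∀ {n : ℕ}, map (LinearMap.id : Euc n →ₗ[ℝ] Euc n) = LinearMap.id)
    {x : X} (α : PlotAt x) :
    ∃ β : PlotAt x, β.plot ∈ G ∧ ∃ L : Euc α.plot.dim →ₗ[ℝ] Euc β.plot.dim,
      ColimFibre.ι F map α = ColimFibre.ι F map β ∘ₗ map L := by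
  obtain ⟨V, hV, hVp, ha, q, hq, f, hf⟩ := hG.exists_isHom hcov α.plot α.pt
  let γ := α.restrict V hV hVp ha
  let β : PlotAt x := ⟨q, ⟨f α.pt, hf.mapsTo γ.pt⟩, (hf.comm γ.pt).trans γ.map_pt⟩
  refine ⟨β, hq, (fderiv ℝ f α.pt).toLinearMap, LinearMap.ext fun v => ?_⟩
  -- The restriction `γ` maps to `α` with identity derivative and to `β` by `f`; the two colimit
  -- relations together identify `α` with `β` along `L`.
  have h1 := ColimFibre.ι_isHom F map γ α _ (α.plot.restrict_isHom V hV hVp) rfl v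
  have h2 := ColimFibre.ι_isHom F map γ β f hf rfl v
  have h3 : (fderiv ℝ (fun y : Euc α.plot.dim => y) γ.pt).toLinearMap = LinearMap.id := by
    rw [fderiv_fun_id]; rfl
  have h4 := (congrArg (fun L => ColimFibre.ι F map α (map L v)) h3).symm.trans h1
  rw [map_id] at h4
  exact h4.trans h2.symm

theorem subsingleton_exteriorPower {n k : ℕ} (h : n < k) : Subsingleton (⋀[ℝ]^k (Euc n)) := by
  apply Module.finrank_zero_iff (R := ℝ) |>.1
  rw [exteriorPower.finrank_eq, finrank_euclideanSpace_fin, Nat.choose_eq_zero_of_lt h]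

theorem Generates.subsingleton_tkSpace {G : Set (Plot X)} (hG : Generates G)
    (hcov : ∀ x, ∃ q ∈ G, ∃ a, q.toFun a = x) {k : ℕ} (hk : ∀ q ∈ G, q.dim < k) (x : X) :
    Subsingleton (TkSpace k x) := by
  have : (LinearMap.id : TkSpace k x →ₗ[ℝ] TkSpace k x) = 0 := by
    refine ColimFibre.hom_ext _ _ fun α => ?_
    obtain ⟨β, hβ, L, h⟩ := hG.exists_ι_comp hcov (fun n => ⋀[ℝ]^k (Euc n))
      (fun L => exteriorPower.map k L) exteriorPower.map_id α
    have := subsingleton_exteriorPower (hk _ hβ)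
    refine LinearMap.ext fun v => ?_
    have h' := LinearMap.congr_fun h v
    rw [LinearMap.comp_apply, Subsingleton.elim (exteriorPower.map k L v) 0] at h'
    exact h'.trans (LinearMap.map_zero _)
  exact subsingleton_of_forall_eq 0 fun v => LinearMap.congr_fun this v

/-- Near each point the form is pulled back from a plot of dimension below `k`, where any `k`
vectors are dependent. Restriction to the neighbourhood pulls back along the identity, so the
original value vanishes too. -/
theorem Generates.form_eq_bot {G : Set (Plot X)} (hG : Generates G)
    (hcov : ∀ x, ∃ q ∈ G, ∃ a, q.toFun a = x) {k : ℕ} (hk : ∀ q ∈ G, q.dim < k) :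
    Form k X = ⊥ := by
  refine (Submodule.eq_bot_iff _).2 fun θ hθ => ?_
  funext p a
  obtain ⟨V, hV, hVp, ha, q, hq, f, hf⟩ := hG.exists_isHom hcov p a
  have h1 := hθ.2 _ p _ (p.restrict_isHom V hV hVp) ⟨a, ha⟩
  have h2 := hθ.2 (p.restrict V hV hVp) q f hf ⟨a, ha⟩
  have hq0 : ∀ η : Euc q.dim [⋀^Fin k]→L[ℝ] ℝ, η = 0 := fun η => by
    ext v
    refine η.toAlternatingMap.map_linearDependent v fun hv => ?_
    have := hv.fintype_card_le_finrank
    rw [Fintype.card_fin, finrank_euclideanSpace_fin] at this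
    exact absurd (hk q hq) (by omega)
  rw [hq0 (θ q _)] at h2
  rw [h2] at h1
  ext v
  have h3 := congrArg (fun η : Euc p.dim [⋀^Fin k]→L[ℝ] ℝ => η v) h1
  have h4 : fderiv ℝ (fun y : Euc p.dim => y) a = ContinuousLinearMap.id ℝ _ := fderiv_fun_id
  have h5 := congrArg
    (fun L : Euc p.dim →L[ℝ] Euc p.dim => (θ p a).compContinuousLinearMap L v) h4
  exact (h3.trans h5).symm

/-- This is the coarsest diffeology with smooth projection. As one of the diffeologies whose infimum
is the dvsification, it makes the projection of `Tᵏ X` smooth. -/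
theorem isPseudoBundle_comap {E : X → Type*} [∀ b, AddCommGroup (E b)] [∀ b, Module ℝ (E b)] :
    IsPseudoBundle (comapDiffeology (Sigma.fst : (Σ b, E b) → X)) where
  smooth_proj _ _ hp := hp
  smooth_add _ _ _ _ hs _ := hs
  smooth_smul _ _ _ _ _ hs := hs
  smooth_zero _ _ hp := hp

theorem TkBundle.smooth_proj (k : ℕ) : DSmooth (TkBundle.proj k X) := by
  intro n P hP
  refine DiffeologicalSpace.isPlot_sInf_iff.1 hP (comapDiffeology Sigma.fst)
    ⟨DiffeologicalSpace.generateFrom_le_iff.2 ?_, isPseudoBundle_comap⟩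
  rintro m _ ⟨p, _, g, hg, w, hgc, -, h⟩
  cases h
  exact p.isPlotOn m g hg hgc

theorem TkBundle.smooth_zero (k : ℕ) : DSmooth (fun x : X => (⟨x, 0⟩ : TkBundle k X)) :=
  fun n p hp => DiffeologicalSpace.isPlot_sInf_iff.2 fun _ hd => hd.2.smooth_zero n p hp

theorem TkBundle.isDiffeomorphism_proj {k : ℕ} (h : ∀ x : X, Subsingleton (TkSpace k x)) :
    IsDiffeomorphism (TkBundle.proj k X) :=
  ⟨TkBundle.smooth_proj k, _, TkBundle.smooth_zero k,
    fun e => Sigma.ext rfl (heq_of_eq ((h e.1).elim _ _)), fun _ => rfl⟩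

/-- A space of finite D-dimension `n` has a generating set of plots of dimension at most `n`
whose images cover the space. -/
theorem exists_generates_of_dDim {n : ℕ} (h : dDim X = n) :
    ∃ G : Set (Plot X), Generates G ∧ (∀ x, ∃ q ∈ G, ∃ a, q.toFun a = x) ∧
      ∀ q ∈ G, q.dim ≤ n := by
  -- The strict bound by `n + 1` yields a generating set without showing that the infimum is
  -- attained.
  have hlt : dDim X < (n + 1 : ℕ) := h ▸ by exact_mod_cast Nat.lt_succ_self n
  obtain ⟨G, hG⟩ := iInf_lt_iff.1 hlt
  obtain ⟨hgen, hG⟩ := iInf_lt_iff.1 hG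
  -- Adjoining all points, of dimension `0`, secures covering and keeps generation.
  refine ⟨G ∪ Set.range Plot.point, fun d' h' => hgen d' fun p hp => h' p (Or.inl hp),
    fun x => ⟨Plot.point x, Or.inr ⟨x, rfl⟩, ⟨0, trivial⟩, rfl⟩, ?_⟩
  rintro q (hq | ⟨x, rfl⟩)
  · have : (q.dim : ℕ∞) < (n + 1 : ℕ) :=
      (le_iSup₂ (f := fun (p : Plot X) (_ : p ∈ G) => (p.dim : ℕ∞)) q hq).trans_lt hG
    exact Nat.lt_succ_iff.1 (by exact_mod_cast this)
  · exact Nat.zero_le n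

/-! ### The differential of a smooth function -/

theorem contDiffOn_extend_comp_plot {φ : X → ℝ} (hφ : DSmooth φ) (p : Plot X) :
    ContDiffOn ℝ ∞ (Function.extend Subtype.val (φ ∘ p.toFun) 0) p.dom :=
  IsPlotOn.contDiffOn_extend p.isOpen_dom fun m g hg hgc => hφ _ _ (p.isPlotOn m g hg hgc)

open Classical in
/-- The linear form on `T_x X` induced by a smooth function `φ`. -/
def differential {φ : X → ℝ} (hφ : DSmooth φ) (x : X) : TanSpace x →ₗ[ℝ] ℝ :=
  (colimRel (fun n => Euc n) (fun L => L) x).liftQ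
    (DirectSum.toModule ℝ (PlotAt x) _ fun α =>
      (fderiv ℝ (Function.extend Subtype.val (φ ∘ α.plot.toFun) 0) α.pt).toLinearMap) (by
      refine Submodule.span_le.2 ?_
      rintro _ ⟨α, β, f, v, hf, hpt, rfl⟩
      simp only [SetLike.mem_coe, LinearMap.mem_ker, map_sub, DirectSum.toModule_lof, sub_eq_zero]
      have hα := α.plot.isOpen_dom.mem_nhds α.pt.2
      have hβ := β.plot.isOpen_dom.mem_nhds β.pt.2
      have h1 := ((contDiffOn_extend_comp_plot hφ β.plot).contDiffAt hβ).differentiableAt (by simp)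
      rw [← hpt] at h1 ⊢
      have h2 := (hf.contDiffOn.contDiffAt hα).differentiableAt (by simp)
      -- The two local expressions of `φ` agree near the base point, so the chain rule gives
      -- compatibility with the colimit relations.
      have h3 : Function.extend Subtype.val (φ ∘ β.plot.toFun) 0 ∘ f =ᶠ[nhds ↑α.pt]
          Function.extend Subtype.val (φ ∘ α.plot.toFun) 0 := by
        filter_upwards [hα] with y hy
        have e1 := Subtype.val_injective.extend_apply (φ ∘ β.plot.toFun) 0
          ⟨f y, hf.mapsTo ⟨y, hy⟩⟩
        have e2 := Subtype.val_injective.extend_apply (φ ∘ α.plot.toFun) 0 ⟨y, hy⟩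
        rw [Function.comp_apply, e1, e2, Function.comp_apply, Function.comp_apply,
          hf.comm ⟨y, hy⟩]
      rw [← h3.fderiv_eq, fderiv_comp _ h1 h2]
      rfl)

open Classical in
theorem differential_tanMap {φ : X → ℝ} (hφ : DSmooth φ) {x : X} (α : PlotAt x)
    (v : Euc α.plot.dim) : differential hφ x (tanMap α v) =
      fderiv ℝ (Function.extend Subtype.val (φ ∘ α.plot.toFun) 0) α.pt v := by
  exact DirectSum.toModule_lof ℝ (φ := fun α : PlotAt x =>
    (fderiv ℝ (Function.extend Subtype.val (φ ∘ α.plot.toFun) 0) α.pt).toLinearMap) α v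

/-- Since `rho` lies over the identity of `X`, a preimage of a vector over `x` is again over `x`. -/
theorem rhoFibre_surjective {k : ℕ} (h : Function.Surjective (rho k X)) (x : X) :
    Function.Surjective (rhoFibre k x) := by
  intro w
  obtain ⟨⟨y, v⟩, hv⟩ := h ⟨x, w⟩
  obtain ⟨hyx, hw⟩ := Sigma.mk.inj_iff.1 hv
  cases hyx
  exact ⟨v, eq_of_heq hw⟩

end Factor

/-! ### The axes -/

namespace Axes

theorem smooth_fst : DSmooth (fun v : Axes => v.1.1) := by
  suffices h : instDiffeologicalSpaceAxes ≤ comapDiffeology (fun v : Axes => v.1.1) from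
    DiffeologicalSpace.le_iff'.1 h
  refine DiffeologicalSpace.generateFrom_le_iff.2 ?_
  rintro _ _ ⟨m, g, hg, h | h⟩ <;> cases h
  exacts [hg, isPlot_const (x := (0 : ℝ))]

theorem smooth_snd : DSmooth (fun v : Axes => v.1.2) := by
  suffices h : instDiffeologicalSpaceAxes ≤ comapDiffeology (fun v : Axes => v.1.2) from
    DiffeologicalSpace.le_iff'.1 h
  refine DiffeologicalSpace.generateFrom_le_iff.2 ?_
  rintro _ _ ⟨m, g, hg, h | h⟩ <;> cases h
  exacts [isPlot_const (x := (0 : ℝ)), hg]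

theorem contDiff_coord : ContDiff ℝ ∞ (fun y : Euc 1 => y 0) := by fun_prop

/-- The first axis as a plot. -/
abbrev plotX : Plot Axes where
  dim := 1
  dom := Set.univ
  isOpen_dom := isOpen_univ
  toFun y := inX (y.1 0)
  isPlotOn m g _ hgc := DiffeologicalSpace.isPlot_generatedFrom_of_mem
    ⟨m, fun y => g y 0, (contDiff_coord.comp hgc).isPlot, Or.inl rfl⟩

/-- The second axis as a plot. -/
abbrev plotY : Plot Axes where
  dim := 1
  dom := Set.univ
  isOpen_dom := isOpen_univ
  toFun y := inY (y.1 0)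
  isPlotOn m g _ hgc := DiffeologicalSpace.isPlot_generatedFrom_of_mem
    ⟨m, fun y => g y 0, (contDiff_coord.comp hgc).isPlot, Or.inr rfl⟩

/-- A real parameter `g` is the coordinate of a map to `ℝ¹`, so each defining plot of the gluing
diffeology is a reparametrised axis. -/
theorem generates : Generates ({plotX, plotY} : Set (Plot Axes)) := by
  intro d' h
  refine DiffeologicalSpace.generateFrom_le_iff.2 ?_
  rintro m _ ⟨_, g, hg, e⟩
  have hg' : ContDiff ℝ ∞ (fun y => (WithLp.toLp 2 fun _ => g y : Euc 1)) :=
    contDiff_euclidean.2 fun _ => hg.contDiff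
  rcases e with e | e <;> cases e
  · exact h plotX (Or.inl rfl) m _ (fun _ => trivial) hg'
  · exact h plotY (Or.inr rfl) m _ (fun _ => trivial) hg'

theorem covers (x : Axes) : ∃ q ∈ ({plotX, plotY} : Set (Plot Axes)), ∃ a, q.toFun a = x := by
  obtain ⟨⟨s, t⟩, h | h⟩ := x
  · obtain rfl : t = 0 := h
    exact ⟨plotX, Or.inl rfl, ⟨WithLp.toLp 2 fun _ => s, trivial⟩, rfl⟩
  · obtain rfl : s = 0 := h
    exact ⟨plotY, Or.inr rfl, ⟨WithLp.toLp 2 fun _ => t, trivial⟩, rfl⟩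

theorem dim_lt : ∀ q ∈ ({plotX, plotY} : Set (Plot Axes)), q.dim < 2 := by
  rintro q (rfl | rfl) <;> exact Nat.one_lt_two

/-- The first axis, pointed at the origin. -/
abbrev pointX : PlotAt origin := ⟨plotX, ⟨0, trivial⟩, rfl⟩

/-- The second axis, pointed at the origin. -/
abbrev pointY : PlotAt origin := ⟨plotY, ⟨0, trivial⟩, rfl⟩

/-- Each axis meets the origin only at parameter `0`. -/
theorem eq_pointX_or_pointY (β : PlotAt origin)
    (h : β.plot ∈ ({plotX, plotY} : Set (Plot Axes))) : β = pointX ∨ β = pointY := by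
  obtain ⟨q, ⟨a, ha⟩, hpt⟩ := β
  rcases h with h | h <;> obtain rfl : q = _ := h
  · left
    have : a = 0 := by
      ext i
      obtain rfl : i = (0 : Fin 1) := Subsingleton.elim (α := Fin 1) _ _
      exact congrArg (fun v : Axes => v.1.1) hpt
    subst this
    rfl
  · right
    have : a = 0 := by
      ext i
      obtain rfl : i = (0 : Fin 1) := Subsingleton.elim (α := Fin 1) _ _
      exact congrArg (fun v : Axes => v.1.2) hpt
    subst this
    rfl

/-! ### The tangent space of the axes at the origin -/

/-- The unit vector of the line. -/
def unit : Euc 1 := EuclideanSpace.single 0 1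

theorem eq_smul_unit (v : Euc 1) : v = v 0 • unit := by
  ext i
  rw [Subsingleton.elim i 0]
  simp [unit]

theorem mem_of_line {M : Type*} [AddCommGroup M] [Module ℝ M] {S : Submodule ℝ M}
    (L : Euc 1 →ₗ[ℝ] M) (v : Euc 1) (h : L unit ∈ S) : L v ∈ S := by
  rw [eq_smul_unit v, map_smul]
  exact S.smul_mem _ h

/-- The tangent vectors of the two axes at the origin. -/
def tangent : Fin 2 → TanSpace origin :=
  ![tanMap pointX unit, tanMap pointY unit]

theorem span_tangent : ⊤ ≤ Submodule.span ℝ (Set.range tangent) := by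
  -- The quotient by the span is tested on the canonical maps, each of which factors through one of
  -- the two pointed axes.
  have key : (Submodule.span ℝ (Set.range tangent)).mkQ = 0 := by
    refine ColimFibre.hom_ext _ _ fun α => ?_
    obtain ⟨β, hβ, L, h⟩ := generates.exists_ι_comp covers (fun n => Euc n) (fun L => L) rfl α
    ext1 v
    rw [h, LinearMap.zero_comp, LinearMap.zero_apply, LinearMap.comp_apply, LinearMap.comp_apply,
      Submodule.mkQ_apply, Submodule.Quotient.mk_eq_zero]
    rcases eq_pointX_or_pointY β hβ with rfl | rfl
    · exact mem_of_line _ _ (Submodule.subset_span ⟨0, rfl⟩)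
    · exact mem_of_line _ _ (Submodule.subset_span ⟨1, rfl⟩)
  intro v _
  exact (Submodule.Quotient.mk_eq_zero _).1 (LinearMap.congr_fun key v)

theorem fderiv_coord (φ : Euc 1 → ℝ) (a v : Euc 1) (c : ℝ) (h : ∀ y, φ y = c * y 0) :
    fderiv ℝ φ a v = c * v 0 := by
  have : φ = fun y => (c • EuclideanSpace.proj (𝕜 := ℝ) (0 : Fin 1) : Euc 1 →L[ℝ] ℝ) y := by
    funext y
    simp [h]
  rw [this, ContinuousLinearMap.fderiv]
  simp

theorem differential_tangent {φ : Axes → ℝ} (hφ : DSmooth φ) {a b : ℝ}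
    (hX : ∀ t, φ (inX t) = a * t) (hY : ∀ t, φ (inY t) = b * t) (i : Fin 2) :
    differential hφ origin (tangent i) = ![a, b] i := by
  have e := fun (ψ : ↥(@Set.univ (Euc 1)) → ℝ) (y : Euc 1) =>
    Subtype.val_injective.extend_apply ψ 0 ⟨y, trivial⟩
  fin_cases i
  · refine (differential_tanMap hφ pointX unit).trans
      ((fderiv_coord _ _ _ a fun y => (e _ y).trans (hX _)).trans ?_)
    simp [unit]
  · refine (differential_tanMap hφ pointY unit).trans
      ((fderiv_coord _ _ _ b fun y => (e _ y).trans (hY _)).trans ?_)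
    simp [unit]

/-- The differentials of the two coordinate functions take the values of a dual basis on these
vectors. -/
theorem linearIndependent_tangent : LinearIndependent ℝ tangent := by
  refine Fintype.linearIndependent_iff.2 fun g hg => ?_
  have key : ∀ {φ : Axes → ℝ} (hφ : DSmooth φ) {a b : ℝ}, (∀ t, φ (inX t) = a * t) →
      (∀ t, φ (inY t) = b * t) → g 0 * a + g 1 * b = 0 := by
    intro φ hφ a b hX hY
    have h := congrArg (differential hφ origin) hg
    rwa [map_sum, map_zero, Fin.sum_univ_two, map_smul, map_smul,
      differential_tangent hφ hX hY, differential_tangent hφ hX hY] at h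
  have h0 := key smooth_fst (a := 1) (b := 0) (fun t => (one_mul t).symm)
    (fun t => (zero_mul t).symm)
  have h1 := key smooth_snd (a := 0) (b := 1) (fun t => (zero_mul t).symm)
    (fun t => (one_mul t).symm)
  intro i
  fin_cases i
  · simpa using h0
  · simpa using h1

theorem finrank_exteriorPower_tanSpace : Module.finrank ℝ (⋀[ℝ]^2 (TanSpace origin)) = 1 := by
  let b := Module.Basis.mk linearIndependent_tangent span_tangent
  have := Module.Finite.of_basis b
  rw [exteriorPower.finrank_eq, Module.finrank_eq_card_basis b]
  rfl

theorem not_surjective_rho : ¬ Function.Surjective (rho 2 Axes) := by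
  intro h
  have hsub := generates.subsingleton_tkSpace covers dim_lt origin
  have := (rhoFibre_surjective h origin).subsingleton
  have h0 := Module.finrank_zero_of_subsingleton (R := ℝ) (M := ⋀[ℝ]^2 (TanSpace origin))
  exact one_ne_zero (finrank_exteriorPower_tanSpace.symm.trans h0)

end Axes

end DiffBundle

end

theorem proposition5p7 :
    (∀ (X : Type u) [DiffeologicalSpace X] (n k : ℕ), DiffBundle.dDim X = n → n < k →
      DiffBundle.IsDiffeomorphism (DiffBundle.TkBundle.proj k X) ∧
      (∀ x : X, Subsingleton (DiffBundle.TkSpace k x)) ∧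
      DiffBundle.Form k X = ⊥) ∧
    Module.finrank ℝ (⋀[ℝ]^2 (DiffBundle.TanSpace DiffBundle.Axes.origin)) = 1 ∧
    ¬ Function.Surjective (DiffBundle.rho 2 DiffBundle.Axes) := by
  refine ⟨fun X _ n k hn hk => ?_, DiffBundle.Axes.finrank_exteriorPower_tanSpace,
    DiffBundle.Axes.not_surjective_rho⟩
  obtain ⟨G, hG, hcov, hdim⟩ := DiffBundle.exists_generates_of_dDim hn
  have hlt := fun q hq => (hdim q hq).trans_lt hk
  have hsub := hG.subsingleton_tkSpace hcov hlt
  exact ⟨DiffBundle.TkBundle.isDiffeomorphism_proj hsub, hsub, hG.form_eq_bot hcov hlt⟩
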